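/- Let $\mathsf H$ be a complex Hilbert space (inner product antilinear in the left entry) and let $Q$ be a normalized positive-operator valued measure (POVM) on the Borel sets of $\mathbb R$ in $\mathsf H$: a map $E\mapsto Q(E)$ into the bounded operators on $\mathsf H$ with $Q(E)\ge 0$ for all $E$, such that $Q_{\varphi,\psi}(E):=\langle\varphi|Q(E)\psi\rangle$ is a complex ($\sigma$-additive) measure for all $\varphi,\psi\in\mathsf H$, and $Q(\mathbb R)=I$. Put $$D:=\Big\{\psi\in\mathsf H\ \Big|\ \int_{\mathbb R}\lambda^2\,dQ_{\psi,\psi}(\lambda)<+\infty\Big\}.$$ A projection-valued measure (PVM) is a normalized POVM $P$ with $P(E)P(F)=P(E\cap F)$ for all $E,F$. For a PVM $P$ on $\mathbb R$ in a Hilbert space $\mathsf K$, $\int_{\mathbb R}\lambda\,dP(\lambda)$ denotes the operator with domain $\{x\in\mathsf K\mid\int\lambda^2\,dP_{x,x}<\infty\}$ that maps $x$ to the limit of the vectors $\sum_c c\,P(s^{-1}\{c\})x$ for simple functions $s$ tending to $\lambda\mapsto\lambda$ in $L^2(\mathbb R,P_{x,x})$. A Naimark dilation triple $(\mathsf K,P_{\mathsf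 H},P)$ of $Q$ consists of a Hilbert space $\mathsf K$ that contains $\mathsf H$ as a closed subspace (through an isometric embedding), the orthogonal projector $P_{\mathsf H}$ of $\mathsf K$ onto $\mathsf H$, and a PVM $P$ on $\mathbb R$ in $\mathsf K$ with $Q(E)=P_{\mathsf H}P(E)|_{\mathsf H}$ for all Borel sets $E$. Operators are linear and defined on a linear subspace; an operator $A$ is Hermitian if $\langle Ax|y\rangle=\langle x|Ay\rangle$ for all $x,y$ in its domain, and symmetric if moreover its domain is dense. Then: (a) $D$ is a linear subspace of $\mathsf H$. It is not necessarily dense or non-trivial: if $\mathsf H\ne\{0\}$, there are normalized POVMs on $\mathbb R$ in $\mathsf H$ for which the corresponding subspace is not dense, and ones for which it is $\{0\}$. (b) For all $\varphi\in\mathsf H$ and $\psi\in D$ the function $\lambda\mapsto\lambda$ is integrable with respect to $Q_{\varphi,\psi}$, and there is a unique operator $A^{(Q)}:D\to\mathsf H$ such that $$\langle\varphi|A^{(Q)}\psi\rangle=\int_{\mathbb R}\lambda\,dQ_{\varphi,\psi}(\lambda)\qquad\text{for all }\varphi\in\mathsf H,\ \psi\in D.$$ (c) $A^{(Q)}$ is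 Hermitian; hence $A^{(Q)}$ is symmetric if and only if $D$ is dense. (d) If $(\mathsf K,P_{\mathsf H},P)$ is a Naimark dilation triple of $Q$, then every $\psi\in D$ lies in the domain of $\int_{\mathbb R}\lambda\,dP(\lambda)$ and $$A^{(Q)}\psi=P_{\mathsf H}\int_{\mathbb R}\lambda\,dP(\lambda)\,\psi .$$ (e) If there is a Naimark dilation triple $(\mathsf K,P_{\mathsf H},P)$ of $Q$ such that $\int_{\mathbb R}\lambda\,dP(\lambda)$ maps $D$ into $\mathsf H$, then $A^{(Q)}$ is closed and $$\|A^{(Q)}\psi\|^2=\int_{\mathbb R}\lambda^2\,dQ_{\psi,\psi}(\lambda)\qquad\text{for all }\psi\in D.$$ -/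

import Mathlib

open MeasureTheory Filter Topology
open scoped ENNReal

noncomputable section

/-- A positive-operator valued measure on the measurable space `Ω` in the Hilbert space `H`.
As for Mathlib's vector measures, `Q` takes the value `0` on non-measurable sets, so that it carries
no information besides its values on the σ-algebra. The inner product is antilinear on the left. -/
structure POVM (Ω : Type*) [MeasurableSpace Ω] (H : Type*) [NormedAddCommGroup H]
    [InnerProductSpace ℂ H] where
  /-- the operator `Q(E)` -/
  op : Set Ω → H →L[ℂ] H
  op_of_not_measurable : ∀ E, ¬ MeasurableSet E → op E = 0
  isPositive : ∀ E, MeasurableSet E → (op E).IsPositive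
  hasSum_inner : ∀ (φ ψ : H) (E : ℕ → Set Ω), (∀ n, MeasurableSet (E n)) →
    Pairwise (fun m n => Disjoint (E m) (E n)) →
    HasSum (fun n => inner ℂ φ (op (E n) ψ)) (inner ℂ φ (op (⋃ n, E n) ψ))

namespace POVM

variable {Ω : Type*} [MeasurableSpace Ω] {H : Type*} [NormedAddCommGroup H]
  [InnerProductSpace ℂ H]

/-- `Q` is normalized if `Q(Ω) = I`. -/
def IsNormalized (Q : POVM Ω H) : Prop := Q.op Set.univ = 1

theorem op_empty (Q : POVM Ω H) : Q.op ∅ = 0 := by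
  ext ψ
  refine ext_inner_left ℂ fun φ => ?_
  have h := Q.hasSum_inner φ ψ (fun _ => ∅) (fun _ => MeasurableSet.empty)
    (fun _ _ _ => by simp)
  have h0 : inner ℂ φ (Q.op ∅ ψ) = 0 := (summable_const_iff _).1 h.summable
  simpa using h0

/-- The complex measure `Q_{φ,ψ}(E) = ⟨φ | Q(E) ψ⟩`. -/
def complexMeasure (Q : POVM Ω H) (φ ψ : H) : ComplexMeasure Ω where
  measureOf' E := inner ℂ φ (Q.op E ψ)
  empty' := by simp [Q.op_empty]
  not_measurable' E hE := by simp [Q.op_of_not_measurable E hE]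
  m_iUnion' E hE hd := Q.hasSum_inner φ ψ E hE hd

/-- The finite positive measure `Q_{ψ,ψ}(E) = ⟨ψ | Q(E) ψ⟩`. -/
def diagMeasure (Q : POVM Ω H) (ψ : H) : Measure Ω :=
  Measure.ofMeasurable (fun E _ => ENNReal.ofReal (inner ℂ ψ (Q.op E ψ)).re)
    (by simp [Q.op_empty])
    (fun E hE hd => by
      have h := (Complex.hasSum_iff _ _).1 (Q.hasSum_inner ψ ψ E hE hd) |>.1
      rw [← h.tsum_eq]
      exact ENNReal.ofReal_tsum_of_nonneg
        (fun n => (Q.isPositive _ (hE n)).re_inner_nonneg_right ψ) h.summable)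

theorem diagMeasure_apply (Q : POVM Ω H) (ψ : H) {E : Set Ω} (hE : MeasurableSet E) :
    Q.diagMeasure ψ E = ENNReal.ofReal (inner ℂ ψ (Q.op E ψ)).re :=
  Measure.ofMeasurable_apply E hE

/-- The set `{ψ | ∫ λ² dQ_{ψ,ψ}(λ) < ∞}` of a POVM on the real line. -/
def sqDomain (Q : POVM ℝ H) : Set H :=
  {ψ | ∫⁻ t, ENNReal.ofReal (t ^ 2) ∂(Q.diagMeasure ψ) < ∞}

/-- `A` is an operator with domain `{ψ | ∫ λ² dQ_{ψ,ψ}(λ) < ∞}` such that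
`⟨φ | A ψ⟩ = ∫ λ dQ_{φ,ψ}(λ)` for all `φ` in `H` and all `ψ` in the domain. -/
def IsWeakIntegral (Q : POVM ℝ H) (A : H →ₗ.[ℂ] H) : Prop :=
  (A.domain : Set H) = Q.sqDomain ∧
    ∀ (φ : H) (ψ : A.domain),
      inner ℂ φ (A ψ) =
        VectorMeasure.integral (Q.complexMeasure φ (ψ : H)) (fun t : ℝ => t)
          (ContinuousLinearMap.lsmul ℝ ℝ)

theorem diagMeasure_add_le (Q : POVM Ω H) (x y : H) :
    Q.diagMeasure (x + y) ≤ (2 : ℝ≥0∞) • (Q.diagMeasure x + Q.diagMeasure y) := by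
  refine Measure.le_iff.2 fun E hE => ?_
  have h1 := (Q.isPositive E hE).re_inner_nonneg_right (x - y)
  have hx := (Q.isPositive E hE).re_inner_nonneg_right x
  have hy := (Q.isPositive E hE).re_inner_nonneg_right y
  simp only [RCLike.re_to_complex] at h1 hx hy
  simp only [Measure.smul_apply, Measure.add_apply, smul_eq_mul, Q.diagMeasure_apply _ hE]
  rw [← ENNReal.ofReal_add hx hy, show (2 : ℝ≥0∞) = ENNReal.ofReal 2 by simp,
    ← ENNReal.ofReal_mul (by norm_num)]
  apply ENNReal.ofReal_le_ofReal
  simp only [map_add, map_sub, inner_add_left, inner_add_right, inner_sub_left, inner_sub_right,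
    Complex.add_re, Complex.sub_re] at h1 ⊢
  linarith

theorem diagMeasure_smul (Q : POVM Ω H) (c : ℂ) (x : H) :
    Q.diagMeasure (c • x) = ENNReal.ofReal (‖c‖ ^ 2) • Q.diagMeasure x := by
  ext E hE
  rw [Measure.smul_apply, Q.diagMeasure_apply _ hE, Q.diagMeasure_apply _ hE, smul_eq_mul,
    ← ENNReal.ofReal_mul (by positivity)]
  congr 1
  rw [map_smul, inner_smul_left, inner_smul_right, ← mul_assoc, ← Complex.normSq_eq_conj_mul_self,
    Complex.re_ofReal_mul, Complex.normSq_eq_norm_sq]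

theorem diagMeasure_zero (Q : POVM Ω H) : Q.diagMeasure 0 = 0 := by
  ext E hE
  simp [Q.diagMeasure_apply _ hE]

instance (Q : POVM Ω H) (x : H) : IsFiniteMeasure (Q.diagMeasure x) :=
  ⟨by rw [Q.diagMeasure_apply _ MeasurableSet.univ]; exact ENNReal.ofReal_lt_top⟩

/-- The set `{ψ | ∫ λ² dQ_{ψ,ψ}(λ) < ∞}` as a subspace. -/
def sqSubmodule (Q : POVM ℝ H) : Submodule ℂ H where
  carrier := Q.sqDomain
  zero_mem' := by simp [sqDomain, Q.diagMeasure_zero]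
  add_mem' := by
    intro x y hx hy
    refine (lintegral_mono' (Q.diagMeasure_add_le x y) le_rfl).trans_lt ?_
    rw [lintegral_smul_measure, lintegral_add_measure]
    exact ENNReal.mul_lt_top (by simp) (ENNReal.add_lt_top.2 ⟨hx, hy⟩)
  smul_mem' := by
    intro c x hx
    change ∫⁻ t, ENNReal.ofReal (t ^ 2) ∂(Q.diagMeasure (c • x)) < ∞
    rw [Q.diagMeasure_smul, lintegral_smul_measure]
    exact ENNReal.mul_lt_top ENNReal.ofReal_lt_top hx

end POVM

/-- A projection-valued measure: a normalized POVM with `P(E) P(F) = P(E ∩ F)`. -/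
structure PVM (Ω : Type*) [MeasurableSpace Ω] (K : Type*) [NormedAddCommGroup K]
    [InnerProductSpace ℂ K] extends POVM Ω K where
  isNormalized : toPOVM.IsNormalized
  op_mul_op : ∀ E F, MeasurableSet E → MeasurableSet F → op E * op F = op (E ∩ F)

namespace PVM

variable {Ω : Type*} [MeasurableSpace Ω] {K : Type*} [NormedAddCommGroup K]
  [InnerProductSpace ℂ K]

/-- The integral `∫ s dP = ∑ c • P(s = c)` of a real simple function. -/
def simpleIntegral (P : PVM Ω K) (s : SimpleFunc Ω ℝ) : K →L[ℂ] K :=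
  ∑ c ∈ s.range, (c : ℂ) • P.op (s ⁻¹' {c})

theorem inner_op_op (P : PVM Ω K) {E F : Set Ω} (hE : MeasurableSet E) (hF : MeasurableSet F)
    (x y : K) : inner ℂ (P.op E x) (P.op F y) = inner ℂ x (P.op (E ∩ F) y) := by
  rw [← P.op_mul_op E F hE hF]
  exact (P.isPositive E hE).inner_left_eq_inner_right x (P.op F y)

theorem enorm_simpleIntegral (P : PVM Ω K) (s : SimpleFunc Ω ℝ) (x : K) :
    ‖P.simpleIntegral s x‖ₑ = eLpNorm s 2 (P.diagMeasure x) := by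
  have hm : ∀ c, MeasurableSet (s ⁻¹' {c}) := s.measurableSet_fiber
  have hpos : ∀ c, 0 ≤ (inner ℂ x (P.op (s ⁻¹' {c}) x)).re := fun c =>
    (P.isPositive _ (hm c)).re_inner_nonneg_right x
  have h1 : ‖P.simpleIntegral s x‖ ^ 2 =
      ∑ c ∈ s.range, c ^ 2 * (inner ℂ x (P.op (s ⁻¹' {c}) x)).re := by
    rw [← inner_self_eq_norm_sq (𝕜 := ℂ), RCLike.re_to_complex]
    simp only [simpleIntegral, sum_apply, smul_apply]
    rw [sum_inner, Complex.re_sum]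
    refine Finset.sum_congr rfl fun c hc => ?_
    rw [inner_sum, Finset.sum_eq_single_of_mem c hc]
    · rw [inner_smul_left, inner_smul_right, P.inner_op_op (hm c) (hm c), Set.inter_self,
        Complex.conj_ofReal, Complex.re_ofReal_mul, Complex.re_ofReal_mul]
      ring
    · intro d _ hdc
      have hdis : s ⁻¹' {c} ∩ s ⁻¹' {d} = ∅ := by
        ext t
        simp only [Set.mem_inter_iff, Set.mem_preimage, Set.mem_singleton_iff,
          Set.mem_empty_iff_false, iff_false, not_and]
        intro h h'
        exact hdc (h'.symm.trans h)
      rw [inner_smul_left, inner_smul_right, P.inner_op_op (hm c) (hm d), hdis,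
        P.toPOVM.op_empty]
      simp
  have h2 : ∫⁻ t, ‖s t‖ₑ ^ 2 ∂(P.diagMeasure x) = ‖P.simpleIntegral s x‖ₑ ^ 2 := by
    have h3 : ∫⁻ t, ‖s t‖ₑ ^ 2 ∂(P.diagMeasure x) =
        (s.map fun r : ℝ => ‖r‖ₑ ^ 2).lintegral (P.diagMeasure x) := by
      rw [← SimpleFunc.lintegral_eq_lintegral]; rfl
    rw [h3, SimpleFunc.map_lintegral, ← ofReal_norm, ← ENNReal.ofReal_pow (norm_nonneg _), h1,
      ENNReal.ofReal_sum_of_nonneg (fun c _ => mul_nonneg (sq_nonneg c) (hpos c))]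
    refine Finset.sum_congr rfl fun c _ => ?_
    rw [P.toPOVM.diagMeasure_apply x (hm c), ENNReal.ofReal_mul (sq_nonneg c),
      Real.enorm_eq_ofReal_abs, ← ENNReal.ofReal_pow (abs_nonneg c), sq_abs]
  rw [eLpNorm_eq_lintegral_rpow_enorm_toReal (by simp) (by simp)]
  simp only [ENNReal.toReal_ofNat, ENNReal.rpow_ofNat, h2]
  rw [← ENNReal.rpow_ofNat, ← ENNReal.rpow_mul]
  simp

theorem simpleIntegral_sub (P : PVM Ω K) (s t : SimpleFunc Ω ℝ) (x : K) :
    P.simpleIntegral (s - t) x = P.simpleIntegral s x - P.simpleIntegral t x := by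
  let T : Set Ω → ℝ →L[ℝ] K := fun E => (ContinuousLinearMap.id ℝ ℝ).smulRight (P.op E x)
  have hT : ∀ u : SimpleFunc Ω ℝ, P.simpleIntegral u x = u.setToSimpleFunc T := by
    intro u
    simp [simpleIntegral, SimpleFunc.setToSimpleFunc, T]
  have hadd : FinMeasAdditive (0 : Measure Ω) T := by
    intro E F hE hF _ _ hd
    have : P.op (E ∪ F) x = P.op E x + P.op F x := by
      refine ext_inner_left ℂ fun φ => ?_
      rw [inner_add_right]
      exact (P.complexMeasure φ x).of_union hd hE hF
    ext
    simp [T, this]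
  rw [hT, hT, hT]
  exact SimpleFunc.setToSimpleFunc_sub T hadd integrable_zero_measure integrable_zero_measure

/-- The filter of simple functions `s` tending to the function `λ ↦ λ` in `L²(ℝ, P_{x,x})`. -/
def approxFilter (P : PVM ℝ K) (x : K) : Filter (SimpleFunc ℝ ℝ) :=
  comap (fun s : SimpleFunc ℝ ℝ => eLpNorm (fun t => s t - t) 2 (P.diagMeasure x)) (𝓝 0)

/-- A sequence of simple functions converging to `λ ↦ λ`. -/
def approxSeq (n : ℕ) : SimpleFunc ℝ ℝ :=
  SimpleFunc.approxOn (fun t : ℝ => t) measurable_id Set.univ 0 (Set.mem_univ 0) n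

theorem tendsto_approxSeq (P : PVM ℝ K) {x : K} (hx : x ∈ P.toPOVM.sqDomain) :
    Tendsto approxSeq atTop (P.approxFilter x) := by
  refine tendsto_comap_iff.2 ?_
  refine SimpleFunc.tendsto_approxOn_Lp_eLpNorm measurable_id (Set.mem_univ 0) (by simp)
    (by simp) ?_
  rw [eLpNorm_lt_top_iff_lintegral_rpow_enorm_lt_top (by simp) (by simp)]
  refine lt_of_eq_of_lt (lintegral_congr fun t => ?_) hx
  simp only [id_eq, sub_zero, ENNReal.toReal_ofNat, ENNReal.rpow_ofNat]
  rw [Real.enorm_eq_ofReal_abs, ← ENNReal.ofReal_pow (abs_nonneg t), sq_abs]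

theorem exists_tendsto_simpleIntegral [CompleteSpace K] (P : PVM ℝ K) {x : K}
    (hx : x ∈ P.toPOVM.sqDomain) :
    ∃ y, Tendsto (fun s => P.simpleIntegral s x) (P.approxFilter x) (𝓝 y) := by
  have hne : (P.approxFilter x).NeBot := (P.tendsto_approxSeq hx).neBot
  refine cauchy_map_iff_exists_tendsto.1 (EMetric.cauchy_iff.2 ⟨(hne.map _).ne, fun ε hε => ?_⟩)
  have hU : {s : SimpleFunc ℝ ℝ | eLpNorm (fun t => s t - t) 2 (P.diagMeasure x) < ε / 2} ∈
      P.approxFilter x :=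
    preimage_mem_comap (Iio_mem_nhds (ENNReal.half_pos hε.ne'))
  refine ⟨_, image_mem_map hU, ?_⟩
  rintro _ ⟨s, hs, rfl⟩ _ ⟨s', hs', rfl⟩
  dsimp only
  rw [edist_eq_enorm_sub, ← P.simpleIntegral_sub, P.enorm_simpleIntegral]
  have h : ⇑(s - s') = (fun t => s t - t) - (fun t => s' t - t) := by
    ext t
    simp
  rw [h]
  have hmeas : ∀ u : SimpleFunc ℝ ℝ,
      AEStronglyMeasurable (fun t => u t - t) (P.diagMeasure x) := fun u =>
    (u.measurable.sub measurable_id).aestronglyMeasurable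
  calc _ ≤ _ := eLpNorm_sub_le (hmeas s) (hmeas s') (by norm_num)
    _ < ε / 2 + ε / 2 := ENNReal.add_lt_add hs hs'
    _ = ε := ENNReal.add_halves ε

/-- The vector `(∫ λ dP(λ)) x`: the limit of `(∫ s dP) x` for simple functions `s` tending to
`λ ↦ λ` in `L²(ℝ, P_{x,x})`. It is used only for `x` with `∫ λ² dP_{x,x} < ∞`, where the limit
exists. -/
def integralVec (P : PVM ℝ K) (x : K) : K :=
  limUnder (P.approxFilter x) (fun s => P.simpleIntegral s x)

theorem tendsto_integralVec [CompleteSpace K] (P : PVM ℝ K) {x : K}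
    (hx : x ∈ P.toPOVM.sqDomain) :
    Tendsto (fun s => P.simpleIntegral s x) (P.approxFilter x) (𝓝 (P.integralVec x)) :=
  tendsto_nhds_limUnder (P.exists_tendsto_simpleIntegral hx)

theorem tendsto_integralVec_seq [CompleteSpace K] (P : PVM ℝ K) {x : K}
    (hx : x ∈ P.toPOVM.sqDomain) :
    Tendsto (fun n => P.simpleIntegral (approxSeq n) x) atTop (𝓝 (P.integralVec x)) :=
  (P.tendsto_integralVec hx).comp (P.tendsto_approxSeq hx)

/-- The operator `∫ λ dP(λ)` with domain `{x | ∫ λ² dP_{x,x}(λ) < ∞}`. -/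
def integral [CompleteSpace K] (P : PVM ℝ K) : K →ₗ.[ℂ] K where
  domain := P.toPOVM.sqSubmodule
  toFun :=
    { toFun := fun x => P.integralVec x
      map_add' := fun x y => by
        refine tendsto_nhds_unique (P.tendsto_integralVec_seq (x + y).2) ?_
        simpa using (P.tendsto_integralVec_seq x.2).add (P.tendsto_integralVec_seq y.2)
      map_smul' := fun c x => by
        refine tendsto_nhds_unique (P.tendsto_integralVec_seq (c • x).2) ?_
        simpa using (P.tendsto_integralVec_seq x.2).const_smul c }

end PVM

/-- A Naimark dilation triple of `Q` on the Hilbert space `K`. The inclusion of `H` in `K` as a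
closed subspace is the isometry `V`, so that `Q(E) = P_H P(E)` on `H` reads `Q(E) = V† P(E) V`. -/
structure NaimarkDilation {Ω : Type*} [MeasurableSpace Ω] {H : Type*} [NormedAddCommGroup H]
    [InnerProductSpace ℂ H] [CompleteSpace H] (Q : POVM Ω H) (K : Type*) [NormedAddCommGroup K]
    [InnerProductSpace ℂ K] [CompleteSpace K] where
  /-- the inclusion of `H` in `K` -/
  V : H →ₗᵢ[ℂ] K
  /-- the projection-valued measure in `K` -/
  P : PVM Ω K
  op_eq : ∀ E, MeasurableSet E →
    Q.op E = ContinuousLinearMap.adjoint V.toContinuousLinearMap ∘L P.op E ∘L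
      V.toContinuousLinearMap

/-- The orthogonal projector `P_H = V V†` of `K` onto (the copy of) `H`. -/
def NaimarkDilation.projH {Ω : Type*} [MeasurableSpace Ω] {H : Type*} [NormedAddCommGroup H]
    [InnerProductSpace ℂ H] [CompleteSpace H] {Q : POVM Ω H} {K : Type*} [NormedAddCommGroup K]
    [InnerProductSpace ℂ K] [CompleteSpace K] (N : NaimarkDilation Q K) : K →L[ℂ] K :=
  N.V.toContinuousLinearMap ∘L ContinuousLinearMap.adjoint N.V.toContinuousLinearMap

/-- A (not necessarily densely defined) operator is Hermitian if `⟨A x | y⟩ = ⟨x | A y⟩` on its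
domain. -/
def LinearPMap.IsHermitianOp {H : Type*} [NormedAddCommGroup H] [InnerProductSpace ℂ H]
    (A : H →ₗ.[ℂ] H) : Prop :=
  ∀ x y : A.domain, inner ℂ (A x) (y : H) = inner ℂ (x : H) (A y)

/-- An operator is symmetric if it is Hermitian and densely defined. -/
def LinearPMap.IsSymmetricOp {H : Type*} [NormedAddCommGroup H] [InnerProductSpace ℂ H]
    (A : H →ₗ.[ℂ] H) : Prop :=
  A.IsHermitianOp ∧ Dense (A.domain : Set H)

end

/-!
Positivity of `Q(E)` and the Cauchy–Schwarz inequality give `|Q_{φ,ψ}(E)|² ≤ Q_{φ,φ}(E) Q_{ψ,ψ}(E)`,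
hence `∫ |f| d|Q_{φ,ψ}| ≤ ‖Q(Ω)‖^{1/2} ‖φ‖ ‖f‖` with the norm of `f` in `L²(Q_{ψ,ψ})`. So `λ` is
integrable with respect to `Q_{φ,ψ}` for `ψ` in the domain, and `s ↦ (∫ s dQ) ψ` is bounded on
simple functions in the norm of `L²(Q_{ψ,ψ})`: the vectors `(∫ s dQ) ψ` converge to `A^(Q) ψ` as
`s → λ`. The integrals of simple functions are Hermitian and compressions of those of a dilation,
and both properties pass to the limit. If `∫ λ dP(λ)` maps the domain into `H`, the compression
loses no norm, so that `‖A^(Q) ψ‖` is the norm of `λ` in `L²(Q_{ψ,ψ})`. That norm is lower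
semicontinuous in `ψ` and finite only on the domain, which makes `A^(Q)` closed. The examples of
small domains are `Q(E) = μ(E) I` with `μ` the Cauchy distribution, which has no second moment.
-/

theorem norm_inner_apply_sq_le {𝕜 E : Type*} [RCLike 𝕜] [NormedAddCommGroup E]
    [InnerProductSpace 𝕜 E] {T : E →ₗ[𝕜] E} (hT : T.IsPositive) (x y : E) :
    ‖inner 𝕜 x (T y)‖ ^ 2 ≤ RCLike.re (inner 𝕜 x (T x)) * RCLike.re (inner 𝕜 y (T y)) := by
  let form : PreInnerProductSpace.Core 𝕜 E :=
    { inner x y := inner 𝕜 x (T y)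
      conj_inner_symm x y := by rw [inner_conj_symm, hT.isSymmetric]
      re_inner_nonneg := hT.re_inner_nonneg_right
      add_left x y z := inner_add_left x y (T z)
      smul_left x y r := inner_smul_left x (T y) r }
  have symm : ‖inner 𝕜 y (T x)‖ = ‖inner 𝕜 x (T y)‖ := by rw [← hT.isSymmetric, norm_inner_symm]
  have cauchySchwarz : ‖inner 𝕜 x (T y)‖ * ‖inner 𝕜 y (T x)‖ ≤
      RCLike.re (inner 𝕜 x (T x)) * RCLike.re (inner 𝕜 y (T y)) :=
    @InnerProductSpace.Core.inner_mul_inner_self_le 𝕜 E _ _ _ form x y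
  rwa [symm, ← sq] at cauchySchwarz

section Variation

variable {Ω V : Type*} [MeasurableSpace Ω] [NormedAddCommGroup V]

theorem variation_apply_le_rpow_mul_rpow {ν : VectorMeasure Ω V} {μ₁ μ₂ : Measure Ω} {p q : ℝ}
    (hpq : p.HolderConjugate q)
    (hν : ∀ E, MeasurableSet E → ‖ν E‖ₑ ≤ μ₁ E ^ (1 / p) * μ₂ E ^ (1 / q))
    {E : Set Ω} (hE : MeasurableSet E) :
    ν.variation E ≤ μ₁ E ^ (1 / p) * μ₂ E ^ (1 / q) := by
  refine le_of_forall_lt fun a ha => ?_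
  obtain ⟨S, hSE, hSd, hSm, hS⟩ := ν.exists_lt_sum_of_lt_variation hE ha
  have sum_measure_le (μ : Measure Ω) : ∑ F ∈ S, μ F ≤ μ E :=
    (measure_biUnion_finset hSd hSm).symm.trans_le (measure_mono (Set.iUnion₂_subset hSE))
  have hp := hpq.pos
  have hq := hpq.symm.pos
  calc a < ∑ F ∈ S, ‖ν F‖ₑ := hS
    _ ≤ ∑ F ∈ S, μ₁ F ^ (1 / p) * μ₂ F ^ (1 / q) :=
        Finset.sum_le_sum fun F hF => hν F (hSm F hF)
    _ ≤ (∑ F ∈ S, (μ₁ F ^ (1 / p)) ^ p) ^ (1 / p) * (∑ F ∈ S, (μ₂ F ^ (1 / q)) ^ q) ^ (1 / q) :=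
        ENNReal.inner_le_Lp_mul_Lq S _ _ hpq
    _ = (∑ F ∈ S, μ₁ F) ^ (1 / p) * (∑ F ∈ S, μ₂ F) ^ (1 / q) := by
        simp only [one_div, ENNReal.rpow_inv_rpow hp.ne', ENNReal.rpow_inv_rpow hq.ne']
    _ ≤ μ₁ E ^ (1 / p) * μ₂ E ^ (1 / q) := by
        gcongr <;> exact sum_measure_le _

theorem lintegral_variation_le {ν : VectorMeasure Ω V} {μ₁ μ₂ : Measure Ω} {p q : ℝ}
    (hpq : p.HolderConjugate q)
    (hν : ∀ E, MeasurableSet E → ‖ν E‖ₑ ≤ μ₁ E ^ (1 / p) * μ₂ E ^ (1 / q)) (f : Ω → ℝ≥0∞) :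
    ∫⁻ t, f t ∂ν.variation ≤ μ₁ Set.univ ^ (1 / p) * (∫⁻ t, f t ^ q ∂μ₂) ^ (1 / q) := by
  have hp := hpq.pos
  have hq := hpq.symm.pos
  rw [lintegral]
  refine iSup₂_le fun g hgf => ?_
  have lintegral_rpow : ∑ c ∈ g.range, c ^ q * μ₂ (g ⁻¹' {c}) = ∫⁻ t, g t ^ q ∂μ₂ := by
    rw [← SimpleFunc.map_lintegral, ← SimpleFunc.lintegral_eq_lintegral]
    rfl
  calc g.lintegral ν.variation = ∑ c ∈ g.range, c * ν.variation (g ⁻¹' {c}) := rfl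
    _ ≤ ∑ c ∈ g.range, μ₁ (g ⁻¹' {c}) ^ (1 / p) * (c * μ₂ (g ⁻¹' {c}) ^ (1 / q)) := by
        refine Finset.sum_le_sum fun c _ => ?_
        rw [mul_left_comm]
        gcongr
        exact variation_apply_le_rpow_mul_rpow hpq hν (g.measurableSet_fiber c)
    _ ≤ (∑ c ∈ g.range, (μ₁ (g ⁻¹' {c}) ^ (1 / p)) ^ p) ^ (1 / p) *
          (∑ c ∈ g.range, (c * μ₂ (g ⁻¹' {c}) ^ (1 / q)) ^ q) ^ (1 / q) :=
        ENNReal.inner_le_Lp_mul_Lq _ _ _ hpq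
    _ = (∑ c ∈ g.range, μ₁ (g ⁻¹' {c})) ^ (1 / p) *
          (∑ c ∈ g.range, c ^ q * μ₂ (g ⁻¹' {c})) ^ (1 / q) := by
        simp only [ENNReal.mul_rpow_of_nonneg _ _ hq.le, one_div, ENNReal.rpow_inv_rpow hp.ne',
          ENNReal.rpow_inv_rpow hq.ne']
    _ = μ₁ Set.univ ^ (1 / p) * (∫⁻ t, g t ^ q ∂μ₂) ^ (1 / q) := by
        rw [g.sum_range_measure_preimage_singleton, lintegral_rpow]
    _ ≤ μ₁ Set.univ ^ (1 / p) * (∫⁻ t, f t ^ q ∂μ₂) ^ (1 / q) := by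
        gcongr
        exact hgf _

theorem integral_complexMeasure_simpleFunc (ν : ComplexMeasure Ω) [IsFiniteMeasure ν.variation]
    (s : SimpleFunc Ω ℝ) :
    ∫ᵛ t, s t ∂•ν = ∑ c ∈ s.range, (c : ℂ) * ν (s ⁻¹' {c}) := by
  rw [VectorMeasure.integral_eq_setToFun, setToFun_simpleFunc _ s s.integrable_of_isFiniteMeasure]
  refine Finset.sum_congr rfl fun c _ => ?_
  simp [transpose_eq_cbmApplyMeasure]

end Variation

theorem tendsto_eLpNorm_of_tendsto_eLpNorm_sub {Ω ι E : Type*} [MeasurableSpace Ω]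
    [NormedAddCommGroup E] {μ : Measure Ω} {p : ℝ≥0∞} [Fact (1 ≤ p)] {l : Filter ι}
    {f : ι → Ω → E} {g : Ω → E} (hf : ∀ i, MemLp (f i) p μ) (hg : MemLp g p μ)
    (hfg : Tendsto (fun i => eLpNorm (f i - g) p μ) l (𝓝 0)) :
    Tendsto (fun i => eLpNorm (f i) p μ) l (𝓝 (eLpNorm g p μ)) := by
  simpa only [Lp.enorm_toLp] using ((Lp.tendsto_Lp_iff_tendsto_eLpNorm'' f hf g hg).2 hfg).enorm

theorem toReal_eLpNorm_two_sq {Ω E : Type*} [MeasurableSpace Ω] [NormedAddCommGroup E]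
    {μ : Measure Ω} {f : Ω → E} (hf : AEStronglyMeasurable f μ) :
    (eLpNorm f 2 μ).toReal ^ 2 = ∫ t, ‖f t‖ ^ 2 ∂μ := by
  rw [toReal_eLpNorm hf, lpNorm_eq_integral_norm_rpow_toReal two_ne_zero ENNReal.ofNat_ne_top hf]
  simp only [ENNReal.toReal_ofNat, Real.rpow_ofNat]
  rw [← one_div, ← Real.sqrt_eq_rpow, Real.sq_sqrt (integral_nonneg fun t => sq_nonneg ‖f t‖)]

theorem cauchySeq_of_edist_le_add {ι E : Type*} [PseudoEMetricSpace E] [Nonempty ι]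
    [SemilatticeSup ι] {u : ι → E} {b : ι → ℝ≥0∞} (hb : Tendsto b atTop (𝓝 0))
    (hu : ∀ i j, edist (u i) (u j) ≤ b i + b j) : CauchySeq u := by
  refine EMetric.cauchySeq_iff.2 fun ε hε => ?_
  obtain ⟨N, hN⟩ := eventually_atTop.1 (hb.eventually_lt_const (ENNReal.half_pos hε.ne'))
  refine ⟨N, fun i hi j hj => (hu i j).trans_lt ?_⟩
  simpa only [ENNReal.add_halves] using ENNReal.add_lt_add (hN i hi) (hN j hj)

theorem isClosed_of_enorm_apply_eq {𝕜 E F : Type*} [NormedField 𝕜] [NormedAddCommGroup E]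
    [NormedSpace 𝕜 E] [NormedAddCommGroup F] [NormedSpace 𝕜 F] {A : E →ₗ.[𝕜] F} {N : E → ℝ≥0∞}
    (hN : LowerSemicontinuous N) (mem_domain : ∀ x, N x < ∞ → x ∈ A.domain)
    (enorm_apply : ∀ x : A.domain, ‖A x‖ₑ = N x) : A.IsClosed := by
  have epigraph_closed : IsClosed {p : E × F | N p.1 ≤ ‖p.2‖ₑ} :=
    hN.isClosed_epigraph.preimage (continuous_fst.prodMk continuous_snd.enorm)
  have le_enorm {p : E × F} (hp : p ∈ A.graph.topologicalClosure) : N p.1 ≤ ‖p.2‖ₑ := by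
    refine closure_minimal (fun q hq => ?_) epigraph_closed hp
    obtain ⟨x, hx, hAx⟩ := A.mem_graph_iff.1 hq
    exact (hx ▸ hAx ▸ enorm_apply x).ge
  refine isClosed_of_closure_subset fun p hp => ?_
  let x : A.domain := ⟨p.1, mem_domain p.1 ((le_enorm hp).trans_lt enorm_lt_top)⟩
  -- `p - q` stays in the closure of the graph for `q` in the graph; then let `q` tend to `p`.
  have bound_closed : IsClosed {q : E × F | ‖A x - q.2‖ₑ ≤ ‖p.2 - q.2‖ₑ} :=
    isClosed_le (by fun_prop) (by fun_prop)
  have bound_self : ‖A x - p.2‖ₑ ≤ ‖p.2 - p.2‖ₑ := by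
    refine closure_minimal (fun q hq => ?_) bound_closed hp
    obtain ⟨y, hy, hAy⟩ := A.mem_graph_iff.1 hq
    have h := le_enorm (sub_mem hp (A.graph.le_topologicalClosure hq))
    rw [Set.mem_ofPred_eq, ← hAy, ← A.map_sub, enorm_apply, hAy]
    simpa [x, hy] using h
  refine A.mem_graph_iff.2 ⟨x, rfl, ?_⟩
  simpa [sub_eq_zero] using bound_self

namespace POVM

variable {Ω : Type*} [MeasurableSpace Ω] {H : Type*} [NormedAddCommGroup H]
  [InnerProductSpace ℂ H]

theorem diagMeasure_univ_le (Q : POVM Ω H) (φ : H) :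
    Q.diagMeasure φ Set.univ ≤ ‖Q.op Set.univ‖ₑ * ‖φ‖ₑ ^ 2 := by
  rw [Q.diagMeasure_apply φ MeasurableSet.univ, ← ofReal_norm, ← ofReal_norm,
    ← ENNReal.ofReal_pow (norm_nonneg _), ← ENNReal.ofReal_mul (norm_nonneg _)]
  refine ENNReal.ofReal_le_ofReal ?_
  calc (inner ℂ φ (Q.op Set.univ φ)).re ≤ ‖inner ℂ φ (Q.op Set.univ φ)‖ := Complex.re_le_norm _
    _ ≤ ‖φ‖ * ‖Q.op Set.univ φ‖ := norm_inner_le_norm _ _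
    _ ≤ ‖φ‖ * (‖Q.op Set.univ‖ * ‖φ‖) := by
        gcongr
        exact (Q.op Set.univ).le_opNorm φ
    _ = ‖Q.op Set.univ‖ * ‖φ‖ ^ 2 := by ring

theorem enorm_complexMeasure_le (Q : POVM Ω H) (φ ψ : H) (E : Set Ω) (hE : MeasurableSet E) :
    ‖Q.complexMeasure φ ψ E‖ₑ ≤
      Q.diagMeasure φ E ^ (1 / 2 : ℝ) * Q.diagMeasure ψ E ^ (1 / 2 : ℝ) := by
  have hφ : 0 ≤ (inner ℂ φ (Q.op E φ)).re := (Q.isPositive E hE).re_inner_nonneg_right φ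
  have cauchySchwarz : ‖Q.complexMeasure φ ψ E‖ ^ 2 ≤
      (inner ℂ φ (Q.op E φ)).re * (inner ℂ ψ (Q.op E ψ)).re :=
    norm_inner_apply_sq_le (Q.isPositive E hE).toLinearMap φ ψ
  rw [← ENNReal.mul_rpow_of_nonneg _ _ (by norm_num), Q.diagMeasure_apply _ hE,
    Q.diagMeasure_apply _ hE, ← ENNReal.ofReal_mul hφ, one_div,
    ENNReal.le_rpow_inv_iff zero_lt_two, ← ofReal_norm, ENNReal.rpow_ofNat,
    ← ENNReal.ofReal_pow (norm_nonneg _)]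
  exact ENNReal.ofReal_le_ofReal cauchySchwarz

theorem variation_complexMeasure_absolutelyContinuous (Q : POVM Ω H) (φ ψ : H) :
    (Q.complexMeasure φ ψ).variation ≪ Q.diagMeasure ψ := by
  refine Measure.AbsolutelyContinuous.mk fun E hE hψ => le_zero_iff.1 ?_
  simpa [hψ] using variation_apply_le_rpow_mul_rpow Real.HolderConjugate.two_two
    (Q.enorm_complexMeasure_le φ ψ) hE

theorem lintegral_enorm_variation_le {E : Type*} [NormedAddCommGroup E] (Q : POVM Ω H) (φ ψ : H)
    (f : Ω → E) :
    ∫⁻ t, ‖f t‖ₑ ∂(Q.complexMeasure φ ψ).variation ≤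
      ‖Q.op Set.univ‖ₑ ^ (1 / 2 : ℝ) * ‖φ‖ₑ * eLpNorm f 2 (Q.diagMeasure ψ) := by
  have diag_rpow_le : Q.diagMeasure φ Set.univ ^ (1 / 2 : ℝ) ≤
      ‖Q.op Set.univ‖ₑ ^ (1 / 2 : ℝ) * ‖φ‖ₑ := by
    calc Q.diagMeasure φ Set.univ ^ (1 / 2 : ℝ)
        ≤ (‖Q.op Set.univ‖ₑ * ‖φ‖ₑ ^ 2) ^ (1 / 2 : ℝ) := by
          gcongr
          exact Q.diagMeasure_univ_le φ
      _ = ‖Q.op Set.univ‖ₑ ^ (1 / 2 : ℝ) * ‖φ‖ₑ := by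
          rw [ENNReal.mul_rpow_of_nonneg _ _ (by norm_num), ← ENNReal.rpow_ofNat,
            ← ENNReal.rpow_mul]
          norm_num
  rw [eLpNorm_eq_lintegral_rpow_enorm_toReal (by simp) (by simp), ENNReal.toReal_ofNat]
  calc ∫⁻ t, ‖f t‖ₑ ∂(Q.complexMeasure φ ψ).variation
      ≤ Q.diagMeasure φ Set.univ ^ (1 / 2 : ℝ) *
          (∫⁻ t, ‖f t‖ₑ ^ (2 : ℝ) ∂(Q.diagMeasure ψ)) ^ (1 / 2 : ℝ) :=
        lintegral_variation_le Real.HolderConjugate.two_two (Q.enorm_complexMeasure_le φ ψ) _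
    _ ≤ _ := by gcongr

theorem integrable_complexMeasure {E : Type*} [NormedAddCommGroup E] (Q : POVM Ω H) (φ : H) {ψ : H}
    {f : Ω → E} (hf : MemLp f 2 (Q.diagMeasure ψ)) : (Q.complexMeasure φ ψ).Integrable f :=
  ⟨hf.1.mono_ac (Q.variation_complexMeasure_absolutelyContinuous φ ψ),
    (Q.lintegral_enorm_variation_le φ ψ f).trans_lt <| ENNReal.mul_lt_top
      (ENNReal.mul_lt_top (ENNReal.rpow_lt_top_of_nonneg (by norm_num) enorm_ne_top)
        enorm_lt_top) hf.2⟩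

instance (Q : POVM Ω H) (φ ψ : H) : IsFiniteMeasure (Q.complexMeasure φ ψ).variation :=
  (integrable_const_iff_isFiniteMeasure one_ne_zero).1
    (Q.integrable_complexMeasure φ (memLp_const (1 : ℝ)))

/-- The integral `∫ s dQ = ∑ c • Q(s = c)` of a real simple function, as in
`PVM.simpleIntegral`. -/
noncomputable def simpleIntegral (Q : POVM Ω H) (s : SimpleFunc Ω ℝ) : H →L[ℂ] H :=
  ∑ c ∈ s.range, (c : ℂ) • Q.op (s ⁻¹' {c})

theorem inner_simpleIntegral (Q : POVM Ω H) (s : SimpleFunc Ω ℝ) (φ ψ : H) :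
    inner ℂ φ (Q.simpleIntegral s ψ) = ∫ᵛ t, s t ∂•(Q.complexMeasure φ ψ) := by
  rw [integral_complexMeasure_simpleFunc]
  simp only [simpleIntegral, sum_apply, smul_apply, inner_sum, inner_smul_right]
  rfl

theorem inner_simpleIntegral_left (Q : POVM Ω H) (s : SimpleFunc Ω ℝ) (x y : H) :
    inner ℂ (Q.simpleIntegral s x) y = inner ℂ x (Q.simpleIntegral s y) := by
  simp only [simpleIntegral, sum_apply, smul_apply, inner_sum, inner_smul_right, sum_inner,
    inner_smul_left, Complex.conj_ofReal]
  refine Finset.sum_congr rfl fun c _ => ?_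
  rw [(Q.isPositive _ (s.measurableSet_fiber c)).inner_left_eq_inner_right]

theorem simpleIntegral_sub (Q : POVM Ω H) (s t : SimpleFunc Ω ℝ) (ψ : H) :
    Q.simpleIntegral (s - t) ψ = Q.simpleIntegral s ψ - Q.simpleIntegral t ψ := by
  refine ext_inner_left ℂ fun φ => ?_
  rw [inner_sub_right, Q.inner_simpleIntegral, Q.inner_simpleIntegral, Q.inner_simpleIntegral,
    ← VectorMeasure.integral_sub s.integrable_of_isFiniteMeasure t.integrable_of_isFiniteMeasure,
    SimpleFunc.coe_sub]

theorem enorm_simpleIntegral_le (Q : POVM Ω H) (s : SimpleFunc Ω ℝ) (ψ : H) :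
    ‖Q.simpleIntegral s ψ‖ₑ ≤
      ‖Q.op Set.univ‖ₑ ^ (1 / 2 : ℝ) * eLpNorm s 2 (Q.diagMeasure ψ) := by
  set w := Q.simpleIntegral s ψ
  rcases eq_or_ne w 0 with h0 | h0
  · simp [h0]
  have mul_self_le : ‖w‖ₑ * ‖w‖ₑ ≤
      ‖w‖ₑ * (‖Q.op Set.univ‖ₑ ^ (1 / 2 : ℝ) * eLpNorm s 2 (Q.diagMeasure ψ)) := by
    calc ‖w‖ₑ * ‖w‖ₑ = ‖inner ℂ w w‖ₑ := by
          rw [inner_self_eq_norm_sq_to_K, enorm_pow, sq]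
          simp [enorm]
      _ = ‖∫ᵛ t, s t ∂•(Q.complexMeasure w ψ)‖ₑ := by
          rw [← Q.inner_simpleIntegral]
      _ ≤ ∫⁻ t, ‖s t‖ₑ ∂(Q.complexMeasure w ψ).variation := by
          simpa only [VectorMeasure.variation_transpose_lsmul] using
            VectorMeasure.enorm_integral_le_lintegral_enorm_transpose
              (μ := Q.complexMeasure w ψ) (B := ContinuousLinearMap.lsmul ℝ ℝ) (f := s)
      _ ≤ ‖Q.op Set.univ‖ₑ ^ (1 / 2 : ℝ) * ‖w‖ₑ * eLpNorm s 2 (Q.diagMeasure ψ) :=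
          Q.lintegral_enorm_variation_le w ψ s
      _ = _ := by rw [mul_comm (_ ^ _), mul_assoc]
  exact (ENNReal.mul_le_mul_iff_right (by simpa using h0) enorm_ne_top).1 mul_self_le

theorem lowerSemicontinuous_lintegral_diagMeasure (Q : POVM Ω H) (f : Ω → ℝ≥0∞) :
    LowerSemicontinuous fun ψ => ∫⁻ t, f t ∂(Q.diagMeasure ψ) := by
  simp only [lintegral_eq_nnreal]
  refine lowerSemicontinuous_biSup fun g _ => Continuous.lowerSemicontinuous ?_
  simp only [SimpleFunc.map_lintegral]
  refine continuous_finsetSum _ fun c _ => ?_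
  simp only [Q.diagMeasure_apply _ (g.measurableSet_fiber c)]
  refine (ENNReal.continuous_const_mul ENNReal.coe_ne_top).comp
    (ENNReal.continuous_ofReal.comp (Complex.continuous_re.comp ?_))
  exact continuous_id.inner (Q.op _).continuous

theorem lowerSemicontinuous_eLpNorm_diagMeasure {E : Type*} [NormedAddCommGroup E] (Q : POVM Ω H)
    (f : Ω → E) {p : ℝ≥0∞} (hp : p ≠ ∞) :
    LowerSemicontinuous fun ψ => eLpNorm f p (Q.diagMeasure ψ) := by
  rcases eq_or_ne p 0 with rfl | hp₀
  · simpa only [eLpNorm_exponent_zero] using lowerSemicontinuous_const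
  simp only [eLpNorm_eq_lintegral_rpow_enorm_toReal hp₀ hp]
  exact ENNReal.continuous_rpow_const.comp_lowerSemicontinuous
    (Q.lowerSemicontinuous_lintegral_diagMeasure _)
    (ENNReal.monotone_rpow_of_nonneg (by positivity))

theorem mem_sqDomain_iff_memLp (Q : POVM ℝ H) (ψ : H) :
    ψ ∈ Q.sqDomain ↔ MemLp (fun t : ℝ => t) 2 (Q.diagMeasure ψ) := by
  have measurable_sq : AEStronglyMeasurable (fun t : ℝ => t ^ 2) (Q.diagMeasure ψ) := by fun_prop
  rw [memLp_two_iff_integrable_sq (by fun_prop), Integrable, and_iff_right measurable_sq,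
    hasFiniteIntegral_iff_ofReal (ae_of_all _ sq_nonneg)]
  rfl

theorem tendsto_eLpNorm_approxSeq_sub (Q : POVM ℝ H) {ψ : H} (hψ : ψ ∈ Q.sqDomain) :
    Tendsto (fun n => eLpNorm (⇑(PVM.approxSeq n) - fun t => t) 2 (Q.diagMeasure ψ)) atTop
      (𝓝 0) := by
  refine SimpleFunc.tendsto_approxOn_Lp_eLpNorm measurable_id (Set.mem_univ 0) (by simp)
    (by simp) ?_
  simpa using ((Q.mem_sqDomain_iff_memLp ψ).1 hψ).2

theorem tendsto_const_mul_eLpNorm_approxSeq_sub (Q : POVM ℝ H) {ψ : H} (hψ : ψ ∈ Q.sqDomain)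
    {C : ℝ≥0∞} (hC : C ≠ ∞) :
    Tendsto (fun n => C * eLpNorm (⇑(PVM.approxSeq n) - fun t => t) 2 (Q.diagMeasure ψ)) atTop
      (𝓝 0) := by
  simpa using ENNReal.Tendsto.const_mul (Q.tendsto_eLpNorm_approxSeq_sub hψ) (Or.inr hC)

theorem tendsto_inner_simpleIntegral (Q : POVM ℝ H) (φ : H) {ψ : H} (hψ : ψ ∈ Q.sqDomain) :
    Tendsto (fun n => inner ℂ φ (Q.simpleIntegral (PVM.approxSeq n) ψ)) atTop
      (𝓝 (∫ᵛ t, t ∂•(Q.complexMeasure φ ψ))) := by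
  simp only [Q.inner_simpleIntegral]
  refine VectorMeasure.tendsto_integral_of_L1 _ measurable_id.aestronglyMeasurable
    (.of_forall fun n => (PVM.approxSeq n).integrable_of_isFiniteMeasure) ?_
  refine tendsto_of_tendsto_of_tendsto_of_le_of_le tendsto_const_nhds
    (Q.tendsto_const_mul_eLpNorm_approxSeq_sub hψ (ENNReal.mul_ne_top ?_ enorm_ne_top))
    (fun _ => zero_le) fun n => Q.lintegral_enorm_variation_le φ ψ _
  exact ENNReal.rpow_ne_top_of_nonneg (by norm_num) enorm_ne_top

theorem cauchySeq_simpleIntegral (Q : POVM ℝ H) {ψ : H} (hψ : ψ ∈ Q.sqDomain) :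
    CauchySeq fun n => Q.simpleIntegral (PVM.approxSeq n) ψ := by
  have const_ne_top : ‖Q.op Set.univ‖ₑ ^ (1 / 2 : ℝ) ≠ ∞ :=
    ENNReal.rpow_ne_top_of_nonneg (by norm_num) enorm_ne_top
  refine cauchySeq_of_edist_le_add
    (Q.tendsto_const_mul_eLpNorm_approxSeq_sub hψ const_ne_top) fun m n => ?_
  have measurable_sub (k : ℕ) :
      AEStronglyMeasurable (⇑(PVM.approxSeq k) - fun t => t) (Q.diagMeasure ψ) :=
    ((PVM.approxSeq k).measurable.sub measurable_id).aestronglyMeasurable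
  rw [edist_eq_enorm_sub, ← Q.simpleIntegral_sub, ← mul_add]
  refine (Q.enorm_simpleIntegral_le _ ψ).trans ?_
  gcongr
  rw [SimpleFunc.coe_sub, ← sub_sub_sub_cancel_right _ _ fun t => t]
  exact eLpNorm_sub_le (measurable_sub m) (measurable_sub n) (by norm_num)

theorem IsWeakIntegral.unique {Q : POVM ℝ H} {A B : H →ₗ.[ℂ] H} (hA : Q.IsWeakIntegral A)
    (hB : Q.IsWeakIntegral B) : A = B := by
  refine LinearPMap.ext (SetLike.coe_injective (hA.1.trans hB.1.symm)) fun x hx hx' => ?_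
  refine ext_inner_left ℂ fun φ => ?_
  rw [hA.2 φ ⟨x, hx⟩, hB.2 φ ⟨x, hx'⟩]

variable [CompleteSpace H]

theorem tendsto_limUnder_simpleIntegral (Q : POVM ℝ H) {ψ : H} (hψ : ψ ∈ Q.sqDomain) :
    Tendsto (fun n => Q.simpleIntegral (PVM.approxSeq n) ψ) atTop
      (𝓝 (limUnder atTop fun n => Q.simpleIntegral (PVM.approxSeq n) ψ)) :=
  (Q.cauchySeq_simpleIntegral hψ).tendsto_limUnder

/-- The operator `A^(Q) = ∫ λ dQ(λ)` with domain `{ψ | ∫ λ² dQ_{ψ,ψ}(λ) < ∞}`, as the strong limit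
of the integrals of the simple functions `PVM.approxSeq n`. -/
noncomputable def firstMoment (Q : POVM ℝ H) : H →ₗ.[ℂ] H where
  domain := Q.sqSubmodule
  toFun :=
    { toFun := fun ψ => limUnder atTop fun n => Q.simpleIntegral (PVM.approxSeq n) (ψ : H)
      map_add' := fun x y => by
        refine tendsto_nhds_unique (Q.tendsto_limUnder_simpleIntegral (x + y).2) ?_
        simpa using (Q.tendsto_limUnder_simpleIntegral x.2).add
          (Q.tendsto_limUnder_simpleIntegral y.2)
      map_smul' := fun c x => by
        refine tendsto_nhds_unique (Q.tendsto_limUnder_simpleIntegral (c • x).2) ?_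
        simpa using (Q.tendsto_limUnder_simpleIntegral x.2).const_smul c }

theorem tendsto_firstMoment (Q : POVM ℝ H) (ψ : Q.firstMoment.domain) :
    Tendsto (fun n => Q.simpleIntegral (PVM.approxSeq n) (ψ : H)) atTop (𝓝 (Q.firstMoment ψ)) :=
  Q.tendsto_limUnder_simpleIntegral ψ.2

theorem isWeakIntegral_firstMoment (Q : POVM ℝ H) : Q.IsWeakIntegral Q.firstMoment :=
  ⟨rfl, fun φ ψ => tendsto_nhds_unique (tendsto_const_nhds.inner (Q.tendsto_firstMoment ψ))
    (Q.tendsto_inner_simpleIntegral φ ψ.2)⟩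

theorem isHermitianOp_firstMoment (Q : POVM ℝ H) : Q.firstMoment.IsHermitianOp := fun x y => by
  refine tendsto_nhds_unique ((Q.tendsto_firstMoment x).inner tendsto_const_nhds) ?_
  simpa only [Q.inner_simpleIntegral_left] using
    tendsto_const_nhds.inner (Q.tendsto_firstMoment y)

theorem isClosed_firstMoment (Q : POVM ℝ H)
    (enorm_apply : ∀ ψ : Q.firstMoment.domain,
      ‖Q.firstMoment ψ‖ₑ = eLpNorm (fun t : ℝ => t) 2 (Q.diagMeasure (ψ : H))) :
    Q.firstMoment.IsClosed :=
  isClosed_of_enorm_apply_eq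
    (Q.lowerSemicontinuous_eLpNorm_diagMeasure (fun t : ℝ => t) ENNReal.ofNat_ne_top)
    (fun ψ hψ => (Q.mem_sqDomain_iff_memLp ψ).2 ⟨measurable_id.aestronglyMeasurable, hψ⟩)
    enorm_apply

end POVM

theorem PVM.enorm_integralVec {K : Type*} [NormedAddCommGroup K] [InnerProductSpace ℂ K]
    [CompleteSpace K] (P : PVM ℝ K) {x : K} (hx : x ∈ P.toPOVM.sqDomain) :
    ‖P.integralVec x‖ₑ = eLpNorm (fun t : ℝ => t) 2 (P.diagMeasure x) := by
  refine tendsto_nhds_unique (P.tendsto_integralVec_seq hx).enorm ?_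
  simp only [P.enorm_simpleIntegral]
  exact tendsto_eLpNorm_of_tendsto_eLpNorm_sub
    (fun n => (approxSeq n).memLp_of_isFiniteMeasure 2 _)
    ((P.mem_sqDomain_iff_memLp x).1 hx) (P.tendsto_eLpNorm_approxSeq_sub hx)

namespace NaimarkDilation

variable {Ω : Type*} [MeasurableSpace Ω] {H : Type*} [NormedAddCommGroup H]
  [InnerProductSpace ℂ H] [CompleteSpace H] {K : Type*} [NormedAddCommGroup K]
  [InnerProductSpace ℂ K] [CompleteSpace K]

theorem diagMeasure_V {Q : POVM Ω H} (N : NaimarkDilation Q K) (ψ : H) :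
    N.P.diagMeasure (N.V ψ) = Q.diagMeasure ψ := by
  ext E hE
  rw [POVM.diagMeasure_apply _ _ hE, POVM.diagMeasure_apply _ _ hE, N.op_eq E hE]
  simp only [ContinuousLinearMap.comp_apply, ContinuousLinearMap.adjoint_inner_right]
  rfl

theorem simpleIntegral_eq {Q : POVM Ω H} (N : NaimarkDilation Q K) (s : SimpleFunc Ω ℝ) (ψ : H) :
    Q.simpleIntegral s ψ = ContinuousLinearMap.adjoint N.V.toContinuousLinearMap
      (N.P.simpleIntegral s (N.V ψ)) := by
  simp only [POVM.simpleIntegral, PVM.simpleIntegral, sum_apply, smul_apply, map_sum, map_smul]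
  refine Finset.sum_congr rfl fun c _ => ?_
  rw [N.op_eq _ (s.measurableSet_fiber c)]
  rfl

theorem V_mem_sqDomain_iff {Q : POVM ℝ H} (N : NaimarkDilation Q K) (ψ : H) :
    N.V ψ ∈ N.P.toPOVM.sqDomain ↔ ψ ∈ Q.sqDomain := by
  simp only [POVM.sqDomain, Set.mem_ofPred_eq, N.diagMeasure_V]

theorem firstMoment_eq {Q : POVM ℝ H} (N : NaimarkDilation Q K) (ψ : Q.firstMoment.domain) :
    Q.firstMoment ψ =
      ContinuousLinearMap.adjoint N.V.toContinuousLinearMap (N.P.integralVec (N.V ψ)) := by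
  refine tendsto_nhds_unique (Q.tendsto_firstMoment ψ) ?_
  simp only [N.simpleIntegral_eq]
  exact ((ContinuousLinearMap.continuous _).tendsto _).comp
    (N.P.tendsto_integralVec_seq ((N.V_mem_sqDomain_iff _).2 ψ.2))

theorem enorm_firstMoment {Q : POVM ℝ H} (N : NaimarkDilation Q K) (ψ : Q.firstMoment.domain)
    (hψ : N.P.integralVec (N.V ψ) ∈ Set.range N.V) :
    ‖Q.firstMoment ψ‖ₑ = eLpNorm (fun t : ℝ => t) 2 (Q.diagMeasure (ψ : H)) := by
  obtain ⟨y, hy⟩ := hψ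
  have firstMoment_eq_y : Q.firstMoment ψ = y := by
    refine ext_inner_left ℂ fun φ => ?_
    rw [N.firstMoment_eq, ← hy, ContinuousLinearMap.adjoint_inner_right]
    exact N.V.inner_map_map φ y
  rw [firstMoment_eq_y, ← N.V.enorm_map, hy,
    N.P.enorm_integralVec ((N.V_mem_sqDomain_iff _).2 ψ.2), N.diagMeasure_V]

end NaimarkDilation

namespace POVM

variable {Ω : Type*} [MeasurableSpace Ω] {H : Type*} [NormedAddCommGroup H]
  [InnerProductSpace ℂ H]

/-- The POVM `E ↦ μ(E) I` of a finite measure `μ`. -/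
noncomputable def ofMeasure (H : Type*) [NormedAddCommGroup H] [InnerProductSpace ℂ H]
    (μ : Measure Ω) [IsFiniteMeasure μ] : POVM Ω H where
  op E := ((μ.toSignedMeasure E : ℝ) : ℂ) • 1
  op_of_not_measurable E hE := by simp [VectorMeasure.not_measurable _ hE]
  isPositive E hE := by
    refine ContinuousLinearMap.IsPositive.smul_of_nonneg ContinuousLinearMap.isPositive_one ?_
    rw [Measure.toSignedMeasure_apply_measurable hE]
    exact_mod_cast measureReal_nonneg
  hasSum_inner φ ψ E hE hd := by
    simp only [smul_apply, one_apply_eq_self, inner_smul_right]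
    exact (Complex.hasSum_ofReal.2 (μ.toSignedMeasure.m_iUnion hE hd)).mul_right _

theorem isNormalized_ofMeasure (μ : Measure Ω) [IsProbabilityMeasure μ] :
    (ofMeasure H μ).IsNormalized := by
  simp [IsNormalized, ofMeasure]

theorem diagMeasure_ofMeasure (μ : Measure Ω) [IsFiniteMeasure μ] (ψ : H) :
    (ofMeasure H μ).diagMeasure ψ = ENNReal.ofReal (‖ψ‖ ^ 2) • μ := by
  ext E hE
  have inner_op : inner ℂ ψ ((ofMeasure H μ).op E ψ) = ((μ.real E * ‖ψ‖ ^ 2 : ℝ) : ℂ) := by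
    simp [ofMeasure, hE, inner_self_eq_norm_sq_to_K]
  rw [diagMeasure_apply _ _ hE, Measure.smul_apply, smul_eq_mul, inner_op, Complex.ofReal_re,
    mul_comm, ENNReal.ofReal_mul (by positivity), ofReal_measureReal]

theorem sqDomain_ofMeasure {μ : Measure ℝ} [IsFiniteMeasure μ]
    (hμ : ∫⁻ t, ENNReal.ofReal (t ^ 2) ∂μ = ∞) : (ofMeasure H μ).sqDomain = {0} := by
  ext ψ
  rcases eq_or_ne ψ 0 with rfl | hψ <;>
    simp [sqDomain, diagMeasure_ofMeasure, lintegral_smul_measure, *]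

end POVM

theorem lintegral_sq_cauchyMeasure :
    ∫⁻ t, ENNReal.ofReal (t ^ 2) ∂(ProbabilityTheory.cauchyMeasure 0 1) = ∞ := by
  have density_mul (t : ℝ) : ProbabilityTheory.cauchyPDF 0 1 t * ENNReal.ofReal (1 + t ^ 2) =
      ENNReal.ofReal Real.pi⁻¹ := by
    rw [ProbabilityTheory.cauchyPDF_def, ← ENNReal.ofReal_mul
      (ProbabilityTheory.cauchyPDF_pos 0 one_ne_zero t).le, ProbabilityTheory.cauchyPDFReal_def]
    congr 1
    simp only [sub_zero, NNReal.coe_one]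
    field_simp
    ring
  have lintegral_one_add_sq :
      ∫⁻ t, ENNReal.ofReal (1 + t ^ 2) ∂(ProbabilityTheory.cauchyMeasure 0 1) = ∞ := by
    rw [ProbabilityTheory.cauchyMeasure_of_scale_ne_zero 0 one_ne_zero,
      lintegral_withDensity_eq_lintegral_mul _ (by fun_prop) (by fun_prop)]
    simp [density_mul, Real.pi_pos]
  simpa [ENNReal.ofReal_add, sq_nonneg, lintegral_add_left] using lintegral_one_add_sq

theorem theorem3p8_general {H : Type*} [NormedAddCommGroup H] [InnerProductSpace ℂ H]
    [CompleteSpace H] (Q : POVM ℝ H) :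
    (∃ S : Submodule ℂ H, (S : Set H) = Q.sqDomain) ∧
    (Nontrivial H →
      (∃ Q' : POVM ℝ H, Q'.IsNormalized ∧ ¬ Dense Q'.sqDomain) ∧
      (∃ Q' : POVM ℝ H, Q'.IsNormalized ∧ Q'.sqDomain = {0})) ∧
    (∀ φ : H, ∀ ψ ∈ Q.sqDomain, (Q.complexMeasure φ ψ).Integrable (fun t : ℝ => t)) ∧
    (∃! A : H →ₗ.[ℂ] H, Q.IsWeakIntegral A) ∧
    ∀ A : H →ₗ.[ℂ] H, Q.IsWeakIntegral A →
      A.IsHermitianOp ∧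
      (A.IsSymmetricOp ↔ Dense Q.sqDomain) ∧
      ∀ (K : Type*) [NormedAddCommGroup K] [InnerProductSpace ℂ K] [CompleteSpace K]
        (N : NaimarkDilation Q K),
        (∀ ψ : A.domain, ∃ h : N.V ψ ∈ N.P.integral.domain,
          N.V (A ψ) = N.projH (N.P.integral ⟨N.V ψ, h⟩)) ∧
        ((∀ x : N.P.integral.domain, (x : K) ∈ N.V '' Q.sqDomain →
            N.P.integral x ∈ Set.range N.V) →
          A.IsClosed ∧
          ∀ ψ : A.domain, ‖A ψ‖ ^ 2 = ∫ t, t ^ 2 ∂(Q.diagMeasure (ψ : H))) := by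
  refine ⟨⟨Q.sqSubmodule, rfl⟩, fun _ => ?_, fun φ ψ hψ => Q.integrable_complexMeasure φ
    ((Q.mem_sqDomain_iff_memLp ψ).1 hψ), ⟨Q.firstMoment, Q.isWeakIntegral_firstMoment,
    fun A hA => hA.unique Q.isWeakIntegral_firstMoment⟩, fun A hA => ?_⟩
  · have normalized := POVM.isNormalized_ofMeasure (H := H) (ProbabilityTheory.cauchyMeasure 0 1)
    have domain_eq := POVM.sqDomain_ofMeasure (H := H) lintegral_sq_cauchyMeasure
    refine ⟨⟨_, normalized, ?_⟩, ⟨_, normalized, domain_eq⟩⟩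
    rw [domain_eq, dense_iff_closure_eq, closure_singleton]
    exact Set.singleton_ne_univ 0
  · obtain rfl := hA.unique Q.isWeakIntegral_firstMoment
    refine ⟨Q.isHermitianOp_firstMoment, and_iff_right Q.isHermitianOp_firstMoment,
      fun K _ _ _ N => ?_⟩
    have V_mem_domain (ψ : Q.firstMoment.domain) : N.V ψ ∈ N.P.integral.domain :=
      (N.V_mem_sqDomain_iff _).2 ψ.2
    refine ⟨fun ψ => ⟨V_mem_domain ψ, congrArg N.V (N.firstMoment_eq ψ)⟩, fun hN => ?_⟩
    have enorm_apply (ψ : Q.firstMoment.domain) :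
        ‖Q.firstMoment ψ‖ₑ = eLpNorm (fun t : ℝ => t) 2 (Q.diagMeasure (ψ : H)) :=
      N.enorm_firstMoment ψ (hN ⟨N.V ψ, V_mem_domain ψ⟩ ⟨ψ, ψ.2, rfl⟩)
    refine ⟨Q.isClosed_firstMoment enorm_apply, fun ψ => ?_⟩
    rw [← toReal_enorm, enorm_apply, toReal_eLpNorm_two_sq (by fun_prop)]
    simp only [Real.norm_eq_abs, sq_abs]

theorem theorem3p8 {H : Type*} [NormedAddCommGroup H] [InnerProductSpace ℂ H] [CompleteSpace H]
    (Q : POVM ℝ H) (hQ : Q.IsNormalized) :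
    -- (a) the domain is a subspace, in general neither dense nor different from `{0}`
    (∃ S : Submodule ℂ H, (S : Set H) = Q.sqDomain) ∧
    (Nontrivial H →
      (∃ Q' : POVM ℝ H, Q'.IsNormalized ∧ ¬ Dense Q'.sqDomain) ∧
      (∃ Q' : POVM ℝ H, Q'.IsNormalized ∧ Q'.sqDomain = {0})) ∧
    -- (b) the integrals converge absolutely and define a unique operator
    (∀ φ : H, ∀ ψ ∈ Q.sqDomain, (Q.complexMeasure φ ψ).Integrable (fun t : ℝ => t)) ∧
    (∃! A : H →ₗ.[ℂ] H, Q.IsWeakIntegral A) ∧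
    ∀ A : H →ₗ.[ℂ] H, Q.IsWeakIntegral A →
      -- (c) it is Hermitian, and symmetric exactly if the domain is dense
      A.IsHermitianOp ∧
      (A.IsSymmetricOp ↔ Dense Q.sqDomain) ∧
      ∀ (K : Type*) [NormedAddCommGroup K] [InnerProductSpace ℂ K] [CompleteSpace K]
        (N : NaimarkDilation Q K),
        -- (d) it is the compression of `∫ λ dP(λ)`
        (∀ ψ : A.domain, ∃ h : N.V ψ ∈ N.P.integral.domain,
          N.V (A ψ) = N.projH (N.P.integral ⟨N.V ψ, h⟩)) ∧
        -- (e) the case that `∫ λ dP(λ)` maps the domain into `H`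
        ((∀ x : N.P.integral.domain, (x : K) ∈ N.V '' Q.sqDomain →
            N.P.integral x ∈ Set.range N.V) →
          A.IsClosed ∧
          ∀ ψ : A.domain, ‖A ψ‖ ^ 2 = ∫ t, t ^ 2 ∂(Q.diagMeasure (ψ : H))) :=
  theorem3p8_general Q
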